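/- Let $X\subseteq\mathbb{R}^3$ be a three-dimensional smooth submanifold with (possibly empty) boundary and corners of $\mathbb{R}^3$, for example a closed box, and let $f:X\to\mathbb{R}^2$ be a smooth, proper, stable map. Here smooth means that $f$ extends smoothly to an open neighbourhood of each point of $X$; proper means that preimages of compact sets are compact (automatic if $X$ is compact); and stable means that every smooth $g:X\to\mathbb{R}^2$ in some neighbourhood of $f$ in the Whitney $C^\infty$ topology has the form $g=\psi\circ f\circ\varphi^{-1}$ with diffeomorphisms $\varphi$ of $X$ and $\psi$ of $\mathbb{R}^2$. The Reeb space $W_f$ is the quotient space of $X$, with the quotient topology, in which two points $a,b$ are identified if $f(a)=f(b)$ and $a,b$ lie in the same connected component of $f^{-1}(f(a))$; let $q_f:X\to W_f$ be the quotient map. The Jacobi set $J_f\subseteq X$ consists of the points $x\in X$ with $\operatorname{rank} df_x<2$ and of the points $x\in\partial X=X\setminus\operatorname{Int}X$ (corners included) around which $f|_{\partial X}:\partial X\to\mathbb{R}^2$ is not a local homeomorphism. The Jacobi structure is $q_f(J_f)$. The regular components of $W_f$ are the path components of $W_f\setminus q_f(J_f)$. Then the Jacobi structure separates $W_f$ into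 $2$-manifolds: $W_f\setminus q_f(J_f)$ is the disjoint union of the regular components, each regular component is open in $W_f$, and each is a topological $2$-manifold without boundary (Hausdorff, second countable and locally homeomorphic to $\mathbb{R}^2$). -/

import Mathlib

open scoped ContDiff

/-- `X ⊆ ℝ³` is a three-dimensional smooth submanifold with corners of `ℝ³` (boundary and corners
may be empty): around each of its points there are smooth coordinates of `ℝ³` in which `X` is given
by the nonnegativity of some of the coordinates. Closed boxes, closed domains with smooth boundary
and `ℝ³` itself are examples. -/
def IsCornerDomain (X : Set (EuclideanSpace ℝ (Fin 3))) : Prop :=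
  ∀ x ∈ X, ∃ (e : OpenPartialHomeomorph (EuclideanSpace ℝ (Fin 3)) (EuclideanSpace ℝ (Fin 3)))
    (S : Set (Fin 3)), x ∈ e.source ∧
      ContDiffOn ℝ ∞ e e.source ∧ ContDiffOn ℝ ∞ e.symm e.target ∧
      ∀ z ∈ e.source, z ∈ X ↔ ∀ i ∈ S, 0 ≤ e z i

/-- Smoothness of a map on a subset `X` that need not be open: near each point of `X` the map is
the restriction of a smooth map defined on an open set. Only the values of `f` on `X` matter. -/
def IsSmoothOn {E F : Type*} [NormedAddCommGroup E] [NormedSpace ℝ E]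
    [NormedAddCommGroup F] [NormedSpace ℝ F] (f : E → F) (X : Set E) : Prop :=
  ∀ x ∈ X, ∃ (U : Set E) (g : E → F), IsOpen U ∧ x ∈ U ∧ ContDiffOn ℝ ∞ g U ∧
    Set.EqOn g f (X ∩ U)

/-- The map `f` on `X` is proper: preimages (in `X`) of compact sets are compact. -/
def IsProperOn (f : EuclideanSpace ℝ (Fin 3) → EuclideanSpace ℝ (Fin 2))
    (X : Set (EuclideanSpace ℝ (Fin 3))) : Prop :=
  ∀ K : Set (EuclideanSpace ℝ (Fin 2)), IsCompact K → IsCompact (X ∩ f ⁻¹' K)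

/-- `f` and `g`, as maps `X → ℝ²`, differ by a diffeomorphism `φ` of `X` (with inverse `φ'`)
and a diffeomorphism `ψ` of `ℝ²`. -/
def AreEquivalentOn (X : Set (EuclideanSpace ℝ (Fin 3)))
    (f g : EuclideanSpace ℝ (Fin 3) → EuclideanSpace ℝ (Fin 2)) : Prop :=
  ∃ (φ φ' : EuclideanSpace ℝ (Fin 3) → EuclideanSpace ℝ (Fin 3))
    (ψ : EuclideanSpace ℝ (Fin 2) ≃ EuclideanSpace ℝ (Fin 2)),
    IsSmoothOn φ X ∧ IsSmoothOn φ' X ∧ Set.MapsTo φ X X ∧ Set.MapsTo φ' X X ∧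
    Set.InvOn φ' φ X X ∧
    ContDiff ℝ ∞ ψ ∧ ContDiff ℝ ∞ ψ.symm ∧
    ∀ x ∈ X, g (φ x) = ψ (f x)

/-- `f : X → ℝ²` is stable: all smooth maps in some neighbourhood of `f` in the Whitney `C^∞`
topology are equivalent to `f`. A basic neighbourhood is given by an order `k` and a positive
continuous function `ε` on `X` that bounds the derivatives of the difference up to order `k`;
if `X` is compact, `ε` may be taken constant. -/
def IsStableOn (f : EuclideanSpace ℝ (Fin 3) → EuclideanSpace ℝ (Fin 2))
    (X : Set (EuclideanSpace ℝ (Fin 3))) : Prop :=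
  ∃ (k : ℕ) (ε : EuclideanSpace ℝ (Fin 3) → ℝ), ContinuousOn ε X ∧ (∀ x ∈ X, 0 < ε x) ∧
    ∀ g : EuclideanSpace ℝ (Fin 3) → EuclideanSpace ℝ (Fin 2), IsSmoothOn g X →
      (∀ x ∈ X, ∀ i ≤ k,
        ‖iteratedFDerivWithin ℝ i g X x - iteratedFDerivWithin ℝ i f X x‖ < ε x) →
      AreEquivalentOn X f g

/-- The boundary `∂X = X \ Int X`, corner points included. -/
def domainBoundary (X : Set (EuclideanSpace ℝ (Fin 3))) : Set (EuclideanSpace ℝ (Fin 3)) :=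
  X \ interior X

/-- `x` is a singular point of `f : X → ℝ²`: the differential `df_x` has rank less than
`min {3, 2} = 2`. The differential is that of any local smooth extension of `f`. -/
def IsSingularPoint (X : Set (EuclideanSpace ℝ (Fin 3)))
    (f : EuclideanSpace ℝ (Fin 3) → EuclideanSpace ℝ (Fin 2))
    (x : EuclideanSpace ℝ (Fin 3)) : Prop :=
  Module.finrank ℝ (fderivWithin ℝ f X x).range < 2

/-- The interior Jacobi set: singular points in the interior of `X`. -/
def interiorJacobiSet (X : Set (EuclideanSpace ℝ (Fin 3)))
    (f : EuclideanSpace ℝ (Fin 3) → EuclideanSpace ℝ (Fin 2)) :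
    Set (EuclideanSpace ℝ (Fin 3)) :=
  {x | x ∈ interior X ∧ IsSingularPoint X f x}

/-- The boundary Jacobi set: boundary points that are singular points of `f`, or around which
the restriction `f|∂X` is not a local homeomorphism. (At a point where `∂X` is smooth and `df` has
rank less than two, the differential of `f|∂X` has rank less than two as well.) -/
def boundaryJacobiSet (X : Set (EuclideanSpace ℝ (Fin 3)))
    (f : EuclideanSpace ℝ (Fin 3) → EuclideanSpace ℝ (Fin 2)) :
    Set (EuclideanSpace ℝ (Fin 3)) :=
  {x | ∃ hx : x ∈ domainBoundary X,
    IsSingularPoint X f x ∨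
      ¬ IsLocalHomeomorphOn ((domainBoundary X).domRestrict f) {⟨x, hx⟩}}

/-- The Jacobi set, the union of the interior and the boundary Jacobi set. -/
def jacobiSet (X : Set (EuclideanSpace ℝ (Fin 3)))
    (f : EuclideanSpace ℝ (Fin 3) → EuclideanSpace ℝ (Fin 2)) :
    Set (EuclideanSpace ℝ (Fin 3)) :=
  interiorJacobiSet X f ∪ boundaryJacobiSet X f

/-- Two points of `X` are equivalent if they have the same value and lie in the same connected
component of the fiber over that value. -/
def reebSetoid (X : Set (EuclideanSpace ℝ (Fin 3)))
    (f : EuclideanSpace ℝ (Fin 3) → EuclideanSpace ℝ (Fin 2)) : Setoid X where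
  r a b := f a = f b ∧
    connectedComponentIn (X ∩ f ⁻¹' {f a}) (a : EuclideanSpace ℝ (Fin 3)) =
      connectedComponentIn (X ∩ f ⁻¹' {f b}) (b : EuclideanSpace ℝ (Fin 3))
  iseqv :=
    ⟨fun _ => ⟨rfl, rfl⟩, fun h => ⟨h.1.symm, h.2.symm⟩,
      fun h h' => ⟨h.1.trans h'.1, h.2.trans h'.2⟩⟩

/-- The Reeb space `W_f`, the set of fiber-components. -/
def ReebSpace (X : Set (EuclideanSpace ℝ (Fin 3)))
    (f : EuclideanSpace ℝ (Fin 3) → EuclideanSpace ℝ (Fin 2)) : Type :=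
  Quotient (reebSetoid X f)

/-- The Reeb space carries the quotient topology. -/
instance ReebSpace.instTopologicalSpace (X : Set (EuclideanSpace ℝ (Fin 3)))
    (f : EuclideanSpace ℝ (Fin 3) → EuclideanSpace ℝ (Fin 2)) :
    TopologicalSpace (ReebSpace X f) :=
  inferInstanceAs (TopologicalSpace (Quotient (reebSetoid X f)))

/-- The quotient map `q_f : X → W_f`. -/
def reebMap (X : Set (EuclideanSpace ℝ (Fin 3)))
    (f : EuclideanSpace ℝ (Fin 3) → EuclideanSpace ℝ (Fin 2)) : X → ReebSpace X f :=
  Quotient.mk (reebSetoid X f)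

/-- The Jacobi structure, the image `q_f(J_f)` of the Jacobi set in the Reeb space. -/
def jacobiStructure (X : Set (EuclideanSpace ℝ (Fin 3)))
    (f : EuclideanSpace ℝ (Fin 3) → EuclideanSpace ℝ (Fin 2)) : Set (ReebSpace X f) :=
  reebMap X f '' {x : X | (x : EuclideanSpace ℝ (Fin 3)) ∈ jacobiSet X f}

/-- The regular components: the classes of points of `W_f` off the Jacobi structure under the
relation of being joined by a path in `W_f` that does not meet the Jacobi structure. -/
def regularComponents (X : Set (EuclideanSpace ℝ (Fin 3)))
    (f : EuclideanSpace ℝ (Fin 3) → EuclideanSpace ℝ (Fin 2)) : Set (Set (ReebSpace X f)) :=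
  {C | ∃ s ∈ (jacobiStructure X f)ᶜ, C = {t | JoinedIn (jacobiStructure X f)ᶜ s t}}

/-- A topological 2-manifold (without boundary): a second countable Hausdorff space that is
locally homeomorphic to the plane. -/
def IsTwoManifold (M : Type*) [TopologicalSpace M] : Prop :=
  T2Space M ∧ SecondCountableTopology M ∧
    Nonempty (ChartedSpace (EuclideanSpace ℝ (Fin 2)) M)

/-!
# Complements of Jacobi structures in Reeb spaces are 2-manifolds

Call a point of `X` regular if it is not in the Jacobi set. The theorem reduces to two local
properties of the proper map `f : X → ℝ²` at a regular point `x`: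

* `f` is open at `x`;
* `x` has a neighbourhood whose intersections with all fibers near that of `x` are connected.

Both hold because a smooth extension of `f` with surjective differential is, in suitable
coordinates of `ℝ³`, the projection `ℝ² × ℝ → ℝ²`. At an interior point nothing more is needed. At
a boundary point the local homeomorphism `f|∂X` has a local inverse, which is a section of `f`
whose image contains all nearby boundary points. So a fiber of `f` near `x` is a relatively closed
subset of an interval, it contains the value of the section, and every other point of it is an
interior point; such a set is an interval (`exists_isOpen_isPreconnected_fiber`). Corners, and
boundary points where `d(f|∂X)` is degenerate, need no separate treatment.

The passage from local to global is `exists_isOpen_fiberComponent`: if a fiber-component `K`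
consists of regular points, then `K` has arbitrarily small open neighbourhoods `U` that are unions
of fiber-components and that meet each fiber in at most one of them. Indeed, cover `K` by finitely
many of the neighbourhoods above; since `f` is open at regular points, those that overlap on `K`
overlap on all nearby fibers, so their union meets nearby fibers in connected sets, and by
properness these sets are clopen in their fibers. On the open subset `q(U)` of the Reeb space the map induced by `f`
is injective, continuous and open, which gives the charts; disjoint neighbourhoods of two
components give the Hausdorff property; and the components are Lindelöf, as continuous images of
subsets of `X`, hence second countable.
-/

open Set Filter Topology

/-! ### Fiber-components of proper maps -/

theorem IsClosed.isClosed_connectedComponentIn {T : Type*} [TopologicalSpace T] {F : Set T}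
    (hF : IsClosed F) (x : T) : IsClosed (connectedComponentIn F x) := by
  by_cases hx : x ∈ F
  · refine isClosed_of_closure_subset ?_
    exact isPreconnected_connectedComponentIn.closure.subset_connectedComponentIn
      (subset_closure (mem_connectedComponentIn hx))
      (hF.closure_subset_iff.2 (connectedComponentIn_subset F x))
  · rw [connectedComponentIn_eq_empty hx]
    exact isClosed_empty

/-- If a preconnected set is covered by open sets each of which meets it, then the graph in which
two of these sets are joined when they overlap on the preconnected set is connected. -/
theorem IsPreconnected.reflTransGen_of_open_cover {T ι : Type*} [TopologicalSpace T] {K : Set T}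
    (hK : IsPreconnected K) {t : Set ι} {N : ι → Set T} (hN : ∀ i ∈ t, IsOpen (N i))
    (hne : ∀ i ∈ t, (N i ∩ K).Nonempty) (hcov : K ⊆ ⋃ i ∈ t, N i) {i j : ι} (hi : i ∈ t)
    (hj : j ∈ t) :
    Relation.ReflTransGen (fun i j => (N i ∩ N j ∩ K).Nonempty ∧ i ∈ t) i j := by
  by_contra hcon
  set r := Relation.ReflTransGen (fun i j => (N i ∩ N j ∩ K).Nonempty ∧ i ∈ t)
  obtain ⟨z, hzK, hz⟩ := hK (⋃ k ∈ {k ∈ t | r i k}, N k) (⋃ k ∈ {k ∈ t | ¬ r i k}, N k)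
    (isOpen_biUnion fun k hk => hN k hk.1) (isOpen_biUnion fun k hk => hN k hk.1)
    (fun z hz => by
      obtain ⟨k, hk, hzk⟩ := mem_iUnion₂.1 (hcov hz)
      by_cases h : r i k
      · exact Or.inl (mem_biUnion (show k ∈ {k ∈ t | r i k} from ⟨hk, h⟩) hzk)
      · exact Or.inr (mem_biUnion (show k ∈ {k ∈ t | ¬ r i k} from ⟨hk, h⟩) hzk))
    (by
      obtain ⟨z, hz, hzK⟩ := hne i hi
      exact ⟨z, hzK, mem_biUnion (show i ∈ {k ∈ t | r i k} from
        ⟨hi, Relation.ReflTransGen.refl⟩) hz⟩)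
    (by
      obtain ⟨z, hz, hzK⟩ := hne j hj
      exact ⟨z, hzK, mem_biUnion (show j ∈ {k ∈ t | ¬ r i k} from ⟨hj, hcon⟩) hz⟩)
  obtain ⟨k, hk, hzk⟩ := mem_iUnion₂.1 hz.1
  obtain ⟨l, hl, hzl⟩ := mem_iUnion₂.1 hz.2
  exact hl.2 (hk.2.tail ⟨⟨z, ⟨hzk, hzl⟩, hzK⟩, hk.1⟩)

/-- The image of a union of fiber-components in the quotient has that union as its preimage. -/
theorem preimage_image_of_fiberComponent_subset {T Y W : Type*} [TopologicalSpace T] {p : T → Y}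
    {q : T → W}
    (hqr : ∀ a b, q a = q b ↔ b ∈ connectedComponentIn (p ⁻¹' {p a}) a) {U : Set T}
    (hU : ∀ a ∈ U, connectedComponentIn (p ⁻¹' {p a}) a ⊆ U) : q ⁻¹' (q '' U) = U := by
  refine Subset.antisymm ?_ (subset_preimage_image q U)
  rintro b ⟨a, ha, hab⟩
  exact hU a ha ((hqr a b).1 hab)

/-- A point of the quotient avoids the image of the non-regular points precisely when its
fiber-component consists of regular points. -/
theorem mem_compl_image_compl_iff {T Y W : Type*} [TopologicalSpace T] {p : T → Y} {R : Set T}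
    {q : T → W}
    (hqr : ∀ a b, q a = q b ↔ b ∈ connectedComponentIn (p ⁻¹' {p a}) a) {x : T} :
    q x ∈ (q '' Rᶜ)ᶜ ↔ connectedComponentIn (p ⁻¹' {p x}) x ⊆ R := by
  constructor
  · intro h b hb
    by_contra hbR
    exact h ⟨b, hbR, ((hqr x b).2 hb).symm⟩
  · rintro h ⟨b, hb, hbx⟩
    exact hb (h ((hqr x b).1 hbx.symm))

section Fibers

variable {T Y : Type*} [TopologicalSpace T] [TopologicalSpace Y] {p : T → Y} {R : Set T}
  {W : Type*} [TopologicalSpace W] {q : T → W} {pbar : W → Y}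

/-- A fiber-component `K` of a proper map `p` that consists of regular points has arbitrarily small
open neighbourhoods that are unions of fiber-components and contain at most one component of each
fiber. Here the points of the open set `R` are regular: `p` is open there, and they have
neighbourhoods that meet nearby fibers in preconnected sets. -/
theorem exists_isOpen_fiberComponent [T2Space T] [T1Space Y] (hp : IsProperMap p) (hR : IsOpen R)
    (hopen : ∀ x ∈ R, 𝓝 (p x) ≤ map p (𝓝 x))
    (hconn : ∀ x ∈ R, ∃ N, IsOpen N ∧ x ∈ N ∧ ∀ᶠ u in 𝓝 (p x), IsPreconnected (N ∩ p ⁻¹' {u}))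
    {x : T} (hx : connectedComponentIn (p ⁻¹' {p x}) x ⊆ R)
    {G : Set T} (hG : IsOpen G) (hxG : connectedComponentIn (p ⁻¹' {p x}) x ⊆ G) :
    ∃ U, IsOpen U ∧ x ∈ U ∧ U ⊆ G ∩ R ∧
      (∀ a ∈ U, connectedComponentIn (p ⁻¹' {p a}) a ⊆ U) ∧
      ∀ a ∈ U, ∀ b ∈ U, p a = p b → b ∈ connectedComponentIn (p ⁻¹' {p a}) a := by
  set F := p ⁻¹' {p x} with hF
  set K := connectedComponentIn F x with hK
  have hxF : x ∈ F := rfl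
  have hxK : x ∈ K := mem_connectedComponentIn hxF
  have hKF : K ⊆ F := connectedComponentIn_subset F x
  have hFc : IsCompact F := hp.isCompact_preimage isCompact_singleton
  have hKc : IsCompact K :=
    hFc.of_isClosed_subset (hFc.isClosed.isClosed_connectedComponentIn x) hKF
  have hKp : IsPreconnected K := isPreconnected_connectedComponentIn
  choose! N hNo hxN hNp using hconn
  obtain ⟨t, htK, htcov⟩ := hKc.elim_nhds_subcover N fun z hz =>
    (hNo z (hx hz)).mem_nhds (hxN z (hx hz))
  have hpz : ∀ z ∈ K, p z = p x := fun z hz => hKF hz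
  set O := ⋃ z ∈ t, N z with hO
  have hOo : IsOpen O := isOpen_biUnion fun z hz => hNo z (hx (htK z hz))
  -- each `N z` meets `F` in a preconnected set through a point of `K`, so `K` is open in `F`
  have hOF : O ∩ F ⊆ K := by
    rintro w ⟨hw, hwF⟩
    obtain ⟨z, hz, hwz⟩ := mem_iUnion₂.1 hw
    have hzK := htK z hz
    have h1 : IsPreconnected (N z ∩ p ⁻¹' {p z}) := (hNp z (hx hzK)).self_of_nhds
    rw [hpz z hzK] at h1
    have h2 := h1.subset_connectedComponentIn ⟨hxN z (hx hzK), hKF hzK⟩ inter_subset_right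
    rw [← hF, ← connectedComponentIn_eq hzK] at h2
    exact h2 ⟨hwz, hwF⟩
  -- openness of `p` carries points over `p x` to points over all nearby values
  have hpush : ∀ z ∈ K, ∀ M, IsOpen M → z ∈ M → ∀ᶠ u in 𝓝 (p x), (M ∩ p ⁻¹' {u}).Nonempty := by
    intro z hz M hM hzM
    have h1 : p '' M ∈ 𝓝 (p z) := hopen z (hx hz) (image_mem_map (hM.mem_nhds hzM))
    rw [hpz z hz] at h1
    filter_upwards [h1] with u hu
    obtain ⟨w, hw, rfl⟩ := hu
    exact ⟨w, hw, rfl⟩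
  have hOconn : ∀ᶠ u in 𝓝 (p x), IsPreconnected (O ∩ p ⁻¹' {u}) := by
    have e1 : ∀ᶠ u in 𝓝 (p x), ∀ z ∈ t, IsPreconnected (N z ∩ p ⁻¹' {u}) := by
      rw [eventually_all_finset]
      intro z hz
      have h := hNp z (hx (htK z hz))
      rwa [hpz z (htK z hz)] at h
    have e2 : ∀ᶠ u in 𝓝 (p x), ∀ z ∈ t, ∀ w ∈ t, (N z ∩ N w ∩ K).Nonempty →
        (N z ∩ N w ∩ p ⁻¹' {u}).Nonempty := by
      simp only [eventually_all_finset]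
      intro z hz w hw
      by_cases h : (N z ∩ N w ∩ K).Nonempty
      · obtain ⟨v, hv, hvK⟩ := h
        filter_upwards [hpush v hvK _ ((hNo z (hx (htK z hz))).inter (hNo w (hx (htK w hw)))) hv]
          with u hu _ using hu
      · exact Eventually.of_forall fun u hu => absurd hu h
    filter_upwards [e1, e2] with u h1 h2
    have h3 : O ∩ p ⁻¹' {u} = ⋃ z ∈ (t : Set T), N z ∩ p ⁻¹' {u} := by
      simp [hO, iUnion_inter]
    rw [h3]
    refine IsPreconnected.biUnion_of_reflTransGen h1 fun z hz w hw => ?_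
    have h4 := hKp.reflTransGen_of_open_cover (t := (t : Set T)) (N := N)
      (fun i hi => hNo i (hx (htK i hi)))
      (fun i hi => ⟨i, hxN i (hx (htK i hi)), htK i hi⟩) htcov hz hw
    -- overlaps on `K` persist on the fiber over `u`
    have h5 : ∀ a b, Relation.ReflTransGen
        (fun i j => (N i ∩ N j ∩ K).Nonempty ∧ i ∈ (t : Set T)) a b → b ∈ (t : Set T) →
        Relation.ReflTransGen
          (fun i j => ((N i ∩ p ⁻¹' {u}) ∩ (N j ∩ p ⁻¹' {u})).Nonempty ∧ i ∈ (t : Set T)) a b := by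
      intro a b hab
      induction hab with
      | refl => exact fun _ => Relation.ReflTransGen.refl
      | tail hab hbc ih =>
        intro hc
        refine (ih hbc.2).tail ⟨?_, hbc.2⟩
        rw [← inter_inter_distrib_right]
        exact h2 _ hbc.2 _ hc hbc.1
    exact h5 z w h4 hw
  -- separating `K` from the rest of its fiber makes the pieces of nearby fibers near `K` clopen
  have hFO : IsCompact (F \ O) := hFc.diff hOo
  obtain ⟨A', B, hA'o, hBo, hKA', hFB, hAB'⟩ := SeparatedNhds.of_isCompact_isCompact hKc hFO
    (disjoint_left.2 fun z hz hz' => hz'.2 (htcov hz))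
  set A := A' ∩ (O ∩ (G ∩ R)) with hA
  have hAo : IsOpen A := hA'o.inter (hOo.inter (hG.inter hR))
  have hKA : K ⊆ A := fun z hz => ⟨hKA' hz, htcov hz, hxG hz, hx hz⟩
  have hAB : Disjoint A B := hAB'.mono_left inter_subset_left
  have hcover : ∀ᶠ u in 𝓝 (p x), ∀ w, p w = u → w ∈ A ∪ B := by
    refine hp.isClosedMap.eventually_nhds_fiber (p := fun w => w ∈ A ∪ B) (p x) fun w hw => ?_
    refine (hAo.union hBo).mem_nhds ?_
    by_cases hwO : w ∈ O
    · exact Or.inl (hKA (hOF ⟨hwO, hw⟩))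
    · exact Or.inr (hFB ⟨hw, hwO⟩)
  obtain ⟨V, hV, hVo, hxV⟩ := eventually_nhds_iff.1
    (hOconn.and (hcover.and (hpush x hxK A hAo (hKA hxK))))
  refine ⟨A ∩ p ⁻¹' V, hAo.inter (hVo.preimage hp.continuous), ⟨hKA hxK, hxV⟩,
    fun a ha => ha.1.2.2, fun a ha => ?_, fun a ha b hb hab => ?_⟩
  · intro b hb
    have hpb : p b = p a :=
      connectedComponentIn_subset (p ⁻¹' {p a}) a hb
    refine ⟨?_, by simpa only [mem_preimage, hpb] using ha.2⟩
    exact isPreconnected_connectedComponentIn.subset_left_of_subset_union hAo hBo hAB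
      (fun w hw => (hV _ ha.2).2.1 w
        (connectedComponentIn_subset (p ⁻¹' {p a}) a hw))
      ⟨a, mem_connectedComponentIn rfl, ha.1⟩ hb
  · exact (hV _ ha.2).1.subset_connectedComponentIn ⟨ha.1.2.1, rfl⟩ inter_subset_right
      ⟨hb.1.2.1, hab.symm⟩

theorem isOpen_compl_image_compl [T2Space T] [T1Space Y] (hp : IsProperMap p) (hR : IsOpen R)
    (hopen : ∀ x ∈ R, 𝓝 (p x) ≤ map p (𝓝 x))
    (hconn : ∀ x ∈ R, ∃ N, IsOpen N ∧ x ∈ N ∧ ∀ᶠ u in 𝓝 (p x), IsPreconnected (N ∩ p ⁻¹' {u}))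
    (hq : IsQuotientMap q)
    (hqr : ∀ a b, q a = q b ↔ b ∈ connectedComponentIn (p ⁻¹' {p a}) a) :
    IsOpen (q '' Rᶜ)ᶜ := by
  rw [← hq.isOpen_preimage, isOpen_iff_mem_nhds]
  intro x hx
  have hx' := (mem_compl_image_compl_iff hqr).1 hx
  obtain ⟨U, hUo, hxU, hUR, hsat, -⟩ := exists_isOpen_fiberComponent hp hR hopen hconn hx'
    isOpen_univ (subset_univ _)
  filter_upwards [hUo.mem_nhds hxU] with a ha
  exact (mem_compl_image_compl_iff hqr).2 fun b hb => (hUR (hsat a ha hb)).2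

/-- The map induced on the space of fiber-components is a local homeomorphism at the components
that consist of regular points. -/
theorem isLocalHomeomorphOn_compl_image_compl [T2Space T] [T1Space Y] (hp : IsProperMap p)
    (hR : IsOpen R) (hopen : ∀ x ∈ R, 𝓝 (p x) ≤ map p (𝓝 x))
    (hconn : ∀ x ∈ R, ∃ N, IsOpen N ∧ x ∈ N ∧ ∀ᶠ u in 𝓝 (p x), IsPreconnected (N ∩ p ⁻¹' {u}))
    (hq : IsQuotientMap q)
    (hqr : ∀ a b, q a = q b ↔ b ∈ connectedComponentIn (p ⁻¹' {p a}) a)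
    (hpbar : ∀ x, pbar (q x) = p x) :
    IsLocalHomeomorphOn pbar (q '' Rᶜ)ᶜ := by
  rw [isLocalHomeomorphOn_iff_isOpenEmbedding_restrict]
  intro w hw
  obtain ⟨x, rfl⟩ := hq.surjective w
  obtain ⟨U, hUo, hxU, hUR, hsat, hinj⟩ := exists_isOpen_fiberComponent hp hR hopen hconn
    ((mem_compl_image_compl_iff hqr).1 hw) isOpen_univ (subset_univ _)
  have hpre : q ⁻¹' (q '' U) = U := preimage_image_of_fiberComponent_subset hqr hsat
  have hqU : IsOpen (q '' U) := by rwa [← hq.isOpen_preimage, hpre]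
  have hcont : Continuous pbar := by
    rw [hq.continuous_iff, show pbar ∘ q = p from funext hpbar]
    exact hp.continuous
  refine ⟨q '' U, hqU.mem_nhds ⟨x, hxU, rfl⟩,
    .of_continuous_injective_isOpenMap (hcont.comp continuous_subtype_val) ?_ ?_⟩
  · rintro ⟨_, a, ha, rfl⟩ ⟨_, b, hb, rfl⟩ hab
    have hab' : p a = p b := by simpa only [domRestrict_apply, hpbar] using hab
    exact Subtype.ext ((hqr a b).2 (hinj a ha b hb hab'))
  · intro S hS
    have hSo : IsOpen (Subtype.val '' S) := hqU.isOpenMap_subtype_val S hS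
    rw [isOpen_iff_mem_nhds]
    rintro _ ⟨⟨_, a, ha, rfl⟩, haS, rfl⟩
    have h1 : q ⁻¹' (Subtype.val '' S) ∈ 𝓝 a :=
      (hSo.preimage hq.continuous).mem_nhds ⟨_, haS, rfl⟩
    have h2 := hopen a (hUR ha).2 (image_mem_map h1)
    rw [domRestrict_apply, hpbar]
    refine mem_of_superset h2 ?_
    rintro _ ⟨b, ⟨c, hcS, hcb⟩, rfl⟩
    exact ⟨c, hcS, by rw [domRestrict_apply, hcb, hpbar]⟩

theorem exists_disjoint_isOpen_of_compl_image_compl [T2Space T] [T1Space Y] (hp : IsProperMap p)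
    (hR : IsOpen R) (hopen : ∀ x ∈ R, 𝓝 (p x) ≤ map p (𝓝 x))
    (hconn : ∀ x ∈ R, ∃ N, IsOpen N ∧ x ∈ N ∧ ∀ᶠ u in 𝓝 (p x), IsPreconnected (N ∩ p ⁻¹' {u}))
    (hq : IsQuotientMap q)
    (hqr : ∀ a b, q a = q b ↔ b ∈ connectedComponentIn (p ⁻¹' {p a}) a) {v w : W}
    (hv : v ∈ (q '' Rᶜ)ᶜ) (hw : w ∈ (q '' Rᶜ)ᶜ) (hvw : v ≠ w) :
    ∃ V V', IsOpen V ∧ IsOpen V' ∧ v ∈ V ∧ w ∈ V' ∧ Disjoint V V' := by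
  obtain ⟨x, rfl⟩ := hq.surjective v
  obtain ⟨y, rfl⟩ := hq.surjective w
  have hcpt : ∀ z, IsCompact (connectedComponentIn (p ⁻¹' {p z}) z) := fun z =>
    have h : IsCompact (p ⁻¹' {p z}) := hp.isCompact_preimage isCompact_singleton
    h.of_isClosed_subset (h.isClosed.isClosed_connectedComponentIn z)
      (connectedComponentIn_subset _ _)
  have hdisj : Disjoint (connectedComponentIn (p ⁻¹' {p x}) x)
      (connectedComponentIn (p ⁻¹' {p y}) y) :=
    disjoint_left.2 fun z hzx hzy => hvw (((hqr x z).2 hzx).trans ((hqr y z).2 hzy).symm)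
  obtain ⟨G, G', hG, hG', hxG, hyG', hGG'⟩ :=
    SeparatedNhds.of_isCompact_isCompact (hcpt x) (hcpt y) hdisj
  obtain ⟨U, hUo, hxU, hUG, hsat, -⟩ := exists_isOpen_fiberComponent hp hR hopen hconn
    ((mem_compl_image_compl_iff hqr).1 hv) hG hxG
  obtain ⟨U', hUo', hyU', hUG', hsat', -⟩ := exists_isOpen_fiberComponent hp hR hopen hconn
    ((mem_compl_image_compl_iff hqr).1 hw) hG' hyG'
  refine ⟨q '' U, q '' U', ?_, ?_, ⟨x, hxU, rfl⟩, ⟨y, hyU', rfl⟩, disjoint_left.2 ?_⟩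
  · rwa [← hq.isOpen_preimage, preimage_image_of_fiberComponent_subset hqr hsat]
  · rwa [← hq.isOpen_preimage, preimage_image_of_fiberComponent_subset hqr hsat']
  · rintro _ ⟨a, ha, rfl⟩ ⟨b, hb, hba⟩
    exact disjoint_left.1 hGG' (hUG (hsat a ha ((hqr a b).1 hba.symm))).1 (hUG' hb).1

end Fibers

/-! ### Manifolds from local homeomorphisms -/

/-- An open set on which a map to `H` is a local homeomorphism is a manifold modelled on `H`. -/
theorem IsLocalHomeomorphOn.nonempty_chartedSpace {W H : Type*} [TopologicalSpace W]
    [TopologicalSpace H] {h : W → H} {S : Set W} (hh : IsLocalHomeomorphOn h S) (hS : IsOpen S) :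
    Nonempty (ChartedSpace H S) := by
  choose e he _ using hh
  let O : TopologicalSpace.Opens W := ⟨S, hS⟩
  let chart : S → OpenPartialHomeomorph S H := fun w =>
    (e w.1 w.2).subtypeRestr (s := O) ⟨w⟩
  exact ⟨{
    atlas := range chart
    chartAt := chart
    mem_chart_source := fun w => by
      simpa [chart, OpenPartialHomeomorph.subtypeRestr_source] using! he w.1 w.2
    chart_mem_atlas := mem_range_self }⟩

theorem isOpen_setOf_joinedIn {W H : Type*} [TopologicalSpace W] [TopologicalSpace H]
    [LocallyPathConnectedSpace H] {S : Set W} (hS : IsOpen S) (hc : Nonempty (ChartedSpace H S))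
    {s : W} (hs : s ∈ S) : IsOpen {t | JoinedIn S s t} := by
  obtain ⟨_⟩ := hc
  have := ChartedSpace.locallyPathConnectedSpace H S
  have heq : {t | JoinedIn S s t} = Subtype.val '' pathComponent (⟨s, hs⟩ : S) := by
    ext t
    constructor
    · intro h
      exact ⟨⟨t, h.target_mem⟩, (joinedIn_iff_joined hs h.target_mem).1 h, rfl⟩
    · rintro ⟨⟨t, ht⟩, h, rfl⟩
      exact (joinedIn_iff_joined hs ht).2 h
  rw [heq]
  exact hS.isOpenMap_subtype_val _ (IsOpen.pathComponent _)

theorem secondCountableTopology_of_isLindelof {W H : Type*} [TopologicalSpace W]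
    [TopologicalSpace H] [SecondCountableTopology H] {S : Set W} (hL : IsLindelof S)
    (hc : Nonempty (ChartedSpace H S)) : SecondCountableTopology S := by
  obtain ⟨_⟩ := hc
  have := isLindelof_iff_lindelofSpace.1 hL
  obtain ⟨s, hs, hcov⟩ := countable_cover_nhds fun x : S =>
    (chartAt H x).open_source.mem_nhds (mem_chart_source H x)
  exact ChartedSpace.secondCountable_of_countable_cover H hcov hs

/-! ### Submersions with one-dimensional fibers -/

/-- A relatively closed subset `D` of an interval that contains `τ` and is a neighbourhood of each
of its other points is an interval: off `τ` it is clopen. -/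
theorem isPreconnected_of_forall_ne_mem_nhds {I D : Set ℝ} {τ : ℝ} (hI : I.OrdConnected)
    (hDI : D ⊆ I) (hcl : closure D ∩ I ⊆ D) (hτ : τ ∈ D) (h : ∀ t ∈ D, t ≠ τ → D ∈ 𝓝 t) :
    IsPreconnected D := by
  have key : ∀ t ∈ D, ∀ J : Set ℝ, IsPreconnected J → J ⊆ uIcc τ t → τ ∉ J → t ∈ J →
      t ≠ τ → J ⊆ D := by
    intro t ht J hJ hJs hτJ htJ hne
    have h1 : J ⊆ interior D := by
      refine hJ.subset_of_closure_inter_subset isOpen_interior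
        ⟨t, htJ, mem_interior_iff_mem_nhds.2 (h t ht hne)⟩ ?_
      rintro v ⟨hv, hvJ⟩
      have hvD : v ∈ D := hcl ⟨closure_mono interior_subset hv,
        hI.uIcc_subset (hDI hτ) (hDI ht) (hJs hvJ)⟩
      exact mem_interior_iff_mem_nhds.2 (h v hvD fun hvτ => hτJ (hvτ ▸ hvJ))
    exact h1.trans interior_subset
  refine (ordConnected_of_uIcc_subset_left (x := τ) fun t ht => ?_).isPreconnected
  rcases lt_trichotomy τ t with hlt | rfl | hlt
  · have h1 := key t ht (Ioc τ t) isPreconnected_Ioc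
      (by rw [uIcc_of_le hlt.le]; exact Ioc_subset_Icc_self) (fun h => lt_irrefl _ h.1)
      ⟨hlt, le_rfl⟩ hlt.ne'
    rw [uIcc_of_le hlt.le, ← Ioc_insert_left hlt.le]
    exact insert_subset hτ h1
  · simpa using ht
  · have h1 := key t ht (Ico t τ) isPreconnected_Ico
      (by rw [uIcc_of_ge hlt.le]; exact Ico_subset_Icc_self) (fun h => lt_irrefl _ h.2)
      ⟨le_rfl, hlt⟩ hlt.ne
    rw [uIcc_of_ge hlt.le, ← Ico_insert_right hlt.le]
    exact insert_subset hτ h1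

section Straightening

variable {E F : Type*} [NormedAddCommGroup E] [NormedSpace ℝ E] [FiniteDimensional ℝ E]
  [NormedAddCommGroup F] [NormedSpace ℝ F] [FiniteDimensional ℝ F]

/-- A submersion with one-dimensional fibers is the projection `F × ℝ → F` in suitable local
coordinates. -/
theorem exists_openPartialHomeomorph_fst_eq
    (hdim : Module.finrank ℝ E = Module.finrank ℝ F + 1) {g : E → F} {x : E}
    (hg : ContDiffAt ℝ 1 g x) (hs : (fderiv ℝ g x).range = ⊤) {U : Set E} (hU : IsOpen U)
    (hx : x ∈ U) : ∃ Φ : OpenPartialHomeomorph E (F × ℝ), x ∈ Φ.source ∧ Φ.source ⊆ U ∧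
      ∀ z, (Φ z).1 = g z := by
  have := FiniteDimensional.complete ℝ E
  have hst := hg.hasStrictFDerivAt one_ne_zero
  have hker : Module.finrank ℝ (fderiv ℝ g x).ker = Module.finrank ℝ ℝ := by
    have h1 := LinearMap.finrank_range_add_finrank_ker (fderiv ℝ g x : E →ₗ[ℝ] F)
    rw [hs, finrank_top] at h1
    rw [Module.finrank_self]
    omega
  let L := ContinuousLinearEquiv.ofFinrankEq hker
  refine ⟨((hst.implicitToOpenPartialHomeomorph g _ hs).transHomeomorph
    ((Homeomorph.refl F).prodCongr L.toHomeomorph)).restrOpen U hU, ⟨?_, hx⟩, ?_, fun z => ?_⟩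
  · exact hst.mem_implicitToOpenPartialHomeomorph_source hs
  · exact inter_subset_right
  · rfl

/-- Let `f` on `X` extend to a submersion `g` near `x`, and let `s` be a continuous local section of
`f` whose image contains all points of `X \ interior X` near `x`. Then nearby fibers of `f` are
connected near `x`: on a fiber line of `g` the set `X` is closed, and each of its points other than
the value of `s` is interior. -/
theorem exists_isOpen_isPreconnected_fiber
    (hdim : Module.finrank ℝ E = Module.finrank ℝ F + 1) {X : Set E} {f g : E → F} {x : E}
    {s : F → E} {Q : Set E} (hclosed : ∀ u, IsClosed (X ∩ f ⁻¹' {u})) (hx : x ∈ X)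
    (hQ : IsOpen Q) (hxQ : x ∈ Q) (hg : ContDiffAt ℝ 1 g x) (hs : (fderiv ℝ g x).range = ⊤)
    (hgf : EqOn g f (X ∩ Q)) (hsx : s (f x) = x) (hsc : ContinuousAt s (f x))
    (hsX : ∀ᶠ u in 𝓝 (f x), s u ∈ X ∧ f (s u) = u)
    (hint : ∀ z ∈ X ∩ Q, z ∈ interior X ∨ s (f z) = z) :
    ∃ N, IsOpen N ∧ x ∈ N ∧ ∀ᶠ u in 𝓝 (f x), IsPreconnected (X ∩ N ∩ f ⁻¹' {u}) := by
  obtain ⟨Φ, hxΦ, hΦQ, hΦg⟩ := exists_openPartialHomeomorph_fst_eq hdim hg hs hQ hxQ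
  obtain ⟨r, hr, hball⟩ := Metric.mem_nhds_iff.1 (Φ.open_target.mem_nhds (Φ.map_source hxΦ))
  have hΦx : (Φ x).1 = f x := (hΦg x).trans (hgf ⟨hx, hxQ⟩)
  set B := Metric.ball (Φ x) r
  set N := Φ.source ∩ Φ ⁻¹' B with hN
  have hNo : IsOpen N := Φ.isOpen_inter_preimage Metric.isOpen_ball
  have hxN : x ∈ N := ⟨hxΦ, Metric.mem_ball_self hr⟩
  have hsN : ∀ᶠ u in 𝓝 (f x), s u ∈ N := hsc (by rw [hsx]; exact hNo.mem_nhds hxN)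
  refine ⟨N, hNo, hxN, ?_⟩
  filter_upwards [hsN, hsX, Metric.ball_mem_nhds (f x) hr] with u huN ⟨huX, hfu⟩ hur
  -- `k` parametrizes the fiber of `g` over `u`, and `D` is the part of it that lies in `X`
  set I := Metric.ball (Φ x).2 r with hI
  set k : ℝ → E := fun t => Φ.symm (u, t) with hk
  have hB : ∀ t ∈ I, (u, t) ∈ B := by
    intro t ht
    rw [← hΦx] at hur
    exact (ball_prod_same (Φ x).1 (Φ x).2 r ▸ mk_mem_prod hur ht : (u, t) ∈ Metric.ball _ r)
  have hkI : ∀ t ∈ I, k t ∈ N ∧ Φ (k t) = (u, t) := fun t ht =>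
    have h1 := Φ.right_inv (hball (hB t ht))
    ⟨⟨Φ.map_target (hball (hB t ht)), by rw [mem_preimage, h1]; exact hB t ht⟩, h1⟩
  have hkc : ∀ t ∈ I, ContinuousAt k t := fun t ht =>
    ContinuousAt.comp (f := fun t : ℝ => (u, t)) (Φ.continuousAt_symm (hball (hB t ht)))
      (by fun_prop)
  set D := {t ∈ I | k t ∈ X ∩ f ⁻¹' {u}} with hD
  have himage : X ∩ N ∩ f ⁻¹' {u} = k '' D := by
    ext z
    constructor
    · rintro ⟨⟨hzX, hzN⟩, hzu⟩
      have hz1 : (Φ z).1 = u := by rw [hΦg, hgf ⟨hzX, hΦQ hzN.1⟩]; exact hzu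
      have hz2 : k (Φ z).2 = z := by
        rw [hk, ← hz1]
        exact Φ.left_inv hzN.1
      have hzI : (Φ z).2 ∈ I := by
        have h1 : Φ z ∈ Metric.ball ((Φ x).1, (Φ x).2) r := hzN.2
        rw [← ball_prod_same] at h1
        exact h1.2
      exact ⟨(Φ z).2, ⟨hzI, by rw [hz2]; exact ⟨hzX, hzu⟩⟩, hz2⟩
    · rintro ⟨t, ⟨htI, htX, htu⟩, rfl⟩
      exact ⟨⟨htX, (hkI t htI).1⟩, htu⟩
  have hDI : D ⊆ I := sep_subset _ _
  have hτ1 : (Φ (s u)).1 = u := by rw [hΦg, hgf ⟨huX, hΦQ huN.1⟩, hfu]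
  have hkτ : k (Φ (s u)).2 = s u := by
    conv_rhs => rw [← Φ.left_inv huN.1]
    rw [hk]
    exact congrArg Φ.symm (Prod.ext hτ1.symm rfl)
  have hτI : (Φ (s u)).2 ∈ I := by
    have h1 : Φ (s u) ∈ Metric.ball ((Φ x).1, (Φ x).2) r := huN.2
    rw [← ball_prod_same] at h1
    exact h1.2
  rw [himage]
  refine IsPreconnected.image (isPreconnected_of_forall_ne_mem_nhds (τ := (Φ (s u)).2)
    (by rw [hI, Real.ball_eq_Ioo]; exact ordConnected_Ioo) hDI ?_ ⟨hτI, ?_⟩ ?_) _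
    fun t ht => (hkc t ht.1).continuousWithinAt
  · rintro t ⟨ht, htI⟩
    refine ⟨htI, (hclosed u).closure_subset_iff.2 ?_
      ((hkc t htI).continuousWithinAt.mem_closure_image ht)⟩
    rintro _ ⟨t', ht', rfl⟩
    exact ht'.2
  · rw [hkτ]
    exact ⟨huX, hfu⟩
  · rintro t ⟨htI, htX, htu⟩ hne
    have hXint : k t ∈ interior X := by
      refine (hint (k t) ⟨htX, hΦQ (hkI t htI).1.1⟩).resolve_right fun h => hne ?_
      rw [show f (k t) = u from htu] at h
      rw [h, (hkI t htI).2]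
    filter_upwards [(hkc t htI) (isOpen_interior.mem_nhds hXint),
      Metric.isOpen_ball.mem_nhds htI] with t' ht' ht'I
    have hX' : k t' ∈ X := interior_subset ht'
    refine ⟨ht'I, hX', ?_⟩
    rw [mem_preimage, ← hgf ⟨hX', hΦQ (hkI t' ht'I).1.1⟩, ← hΦg, (hkI t' ht'I).2]
    rfl

/-- A submersion has a local section through each point. -/
theorem exists_continuousAt_section
    (hdim : Module.finrank ℝ E = Module.finrank ℝ F + 1) {g : E → F} {x : E}
    (hg : ContDiffAt ℝ 1 g x) (hs : (fderiv ℝ g x).range = ⊤) :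
    ∃ s : F → E, s (g x) = x ∧ ContinuousAt s (g x) ∧ ∀ᶠ u in 𝓝 (g x), g (s u) = u := by
  obtain ⟨Φ, hxΦ, -, hΦg⟩ := exists_openPartialHomeomorph_fst_eq hdim hg hs isOpen_univ
    (mem_univ x)
  have hpair : (g x, (Φ x).2) = Φ x := Prod.ext (hΦg x).symm rfl
  have hcont : ContinuousAt (fun u : F => (u, (Φ x).2)) (g x) := by fun_prop
  have htgt : (g x, (Φ x).2) ∈ Φ.target := hpair ▸ Φ.map_source hxΦ
  refine ⟨fun u => Φ.symm (u, (Φ x).2), ?_, ?_, ?_⟩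
  · simp only [hpair, Φ.left_inv hxΦ]
  · exact ContinuousAt.comp (f := fun u : F => (u, (Φ x).2)) (Φ.continuousAt_symm htgt) hcont
  · filter_upwards [hcont (Φ.open_target.mem_nhds htgt)] with u hu
    rw [← hΦg, Φ.right_inv hu]

end Straightening

/-- Surjectivity of the differential is an open condition. -/
theorem eventually_range_fderiv_eq_top {E F : Type*} [NormedAddCommGroup E]
    [NormedSpace ℝ E] [NormedAddCommGroup F] [NormedSpace ℝ F] [FiniteDimensional ℝ F]
    {g : E → F} {x : E} (hg : ContDiffAt ℝ 1 g x)
    (hs : (fderiv ℝ g x).range = ⊤) : ∀ᶠ z in 𝓝 x, (fderiv ℝ g z).range = ⊤ := by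
  obtain ⟨σ, hσ⟩ := ContinuousLinearMap.exists_rightInverse_of_surjective _ hs
  have := FiniteDimensional.complete ℝ F
  have hc : ContinuousAt (fun z => fderiv ℝ g z ∘L σ) x :=
    (hg.continuousAt_fderiv one_ne_zero).clm_comp continuousAt_const
  have hu : IsUnit (fderiv ℝ g x ∘L σ) := by
    rw [hσ]
    exact isUnit_one
  -- near `x` the composite with a right inverse `σ` of the differential at `x` stays invertible
  filter_upwards [hc (Units.isOpen.mem_nhds hu)] with z hz
  obtain ⟨v, hv⟩ := hz
  rw [LinearMap.range_eq_top]
  intro w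
  refine ⟨σ ((↑v⁻¹ : F →L[ℝ] F) w), ?_⟩
  have h1 := congrArg (fun A : F →L[ℝ] F => A w) v.mul_inv
  rw [hv] at h1
  exact h1

/-! ### Maps on domains with corners -/

section CornerDomain

variable {X : Set (EuclideanSpace ℝ (Fin 3))}
  {f : EuclideanSpace ℝ (Fin 3) → EuclideanSpace ℝ (Fin 2)}

theorem uniqueDiffOn_nonneg_coordinates {ι : Type*} [Fintype ι] (S : Set ι) :
    UniqueDiffOn ℝ {v : EuclideanSpace ℝ ι | ∀ i ∈ S, 0 ≤ v i} := by
  refine uniqueDiffOn_convex ?_ ⟨WithLp.toLp 2 fun _ => 1, ?_⟩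
  · intro v hv w hw a b ha hb _ i hi
    have h1 := mul_nonneg ha (hv i hi)
    have h2 := mul_nonneg hb (hw i hi)
    simpa using add_nonneg h1 h2
  · have hopen : IsOpen {v : EuclideanSpace ℝ ι | ∀ i, 0 < v i} := by
      rw [ofPred_forall]
      exact isOpen_iInter_of_finite fun i => isOpen_lt continuous_const (by fun_prop)
    exact mem_interior.2 ⟨_, fun v hv i _ => (hv i).le, hopen, fun i => by simp⟩

/-- Derivatives within a domain with corners are unique, since its charts carry it to convex sets
with nonempty interior. So `fderivWithin ℝ f X` is the derivative of any smooth extension of `f`. -/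
theorem IsCornerDomain.uniqueDiffOn (hX : IsCornerDomain X) : UniqueDiffOn ℝ X := by
  intro x hx
  obtain ⟨e, S, hxe, he, he', hXe⟩ := hX x hx
  have hd : HasFDerivAt e (fderiv ℝ e x) x :=
    ((he.contDiffAt (e.open_source.mem_nhds hxe)).differentiableAt (by simp)).hasFDerivAt
  have hd' : HasFDerivAt e.symm (fderiv ℝ e.symm (e x)) (e x) :=
    ((he'.contDiffAt (e.open_target.mem_nhds (e.map_source hxe))).differentiableAt
      (by simp)).hasFDerivAt
  have hcomp : (fderiv ℝ e.symm (e x)).comp (fderiv ℝ e x) = ContinuousLinearMap.id ℝ _ :=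
    (hd'.comp x hd).unique ((hasFDerivAt_id x).congr_of_eventuallyEq (by
      filter_upwards [e.open_source.mem_nhds hxe] with z hz using e.left_inv hz))
  have hsurj : Function.Surjective (fderiv ℝ e.symm (e x)) := fun v =>
    ⟨fderiv ℝ e x v, congrArg (fun A => A v) hcomp⟩
  have h1 := (uniqueDiffOn_nonneg_coordinates S (e x) ((hXe x hxe).1 hx)).inter
    (e.open_target.mem_nhds (e.map_source hxe))
  have h2 := hd'.hasFDerivWithinAt.uniqueDiffWithinAt h1 hsurj.denseRange
  rw [e.left_inv hxe] at h2
  refine h2.mono ?_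
  rintro _ ⟨v, ⟨hvS, hvt⟩, rfl⟩
  rw [hXe _ (e.map_target hvt), e.right_inv hvt]
  exact hvS

theorem exists_contDiffOn_extension (hX : IsCornerDomain X) (hf : IsSmoothOn f X)
    {x : EuclideanSpace ℝ (Fin 3)} (hx : x ∈ X) :
    ∃ (U : Set (EuclideanSpace ℝ (Fin 3)))
      (g : EuclideanSpace ℝ (Fin 3) → EuclideanSpace ℝ (Fin 2)), IsOpen U ∧ x ∈ U ∧
      (∀ z ∈ U, ContDiffAt ℝ 1 g z) ∧ EqOn g f (X ∩ U) ∧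
      ∀ z ∈ X ∩ U, fderivWithin ℝ f X z = fderiv ℝ g z := by
  obtain ⟨U, g, hU, hxU, hg, hgf⟩ := hf x hx
  have hg1 : ∀ z ∈ U, ContDiffAt ℝ 1 g z := fun z hz =>
    (hg.contDiffAt (hU.mem_nhds hz)).of_le (by exact_mod_cast le_top)
  refine ⟨U, g, hU, hxU, hg1, hgf, fun z hz => ?_⟩
  have h1 : g =ᶠ[𝓝[X] z] f := by
    filter_upwards [self_mem_nhdsWithin, mem_nhdsWithin_of_mem_nhds (hU.mem_nhds hz.2)]
      with w hwX hwU using hgf ⟨hwX, hwU⟩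
  rw [← h1.fderivWithin_eq (hgf hz), DifferentiableAt.fderivWithin
    ((hg1 z hz.2).differentiableAt one_ne_zero) (hX.uniqueDiffOn z hz.1)]

theorem IsSmoothOn.continuousOn (hf : IsSmoothOn f X) : ContinuousOn f X := by
  intro x hx
  obtain ⟨U, g, hU, hxU, hg, hgf⟩ := hf x hx
  refine ((hg.continuousOn.continuousAt (hU.mem_nhds hxU)).continuousWithinAt).congr_of_eventuallyEq
    ?_ (hgf ⟨hx, hxU⟩).symm
  filter_upwards [self_mem_nhdsWithin, mem_nhdsWithin_of_mem_nhds (hU.mem_nhds hxU)]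
    with w hwX hwU using (hgf ⟨hwX, hwU⟩).symm

theorem not_isSingularPoint_iff {x : EuclideanSpace ℝ (Fin 3)} :
    ¬ IsSingularPoint X f x ↔ (fderivWithin ℝ f X x).range = ⊤ := by
  rw [IsSingularPoint, not_lt]
  constructor
  · intro h
    refine Submodule.eq_top_of_finrank_eq (le_antisymm (Submodule.finrank_le _) ?_)
    simpa using h
  · intro h
    rw [h, finrank_top]
    simp

theorem notMem_jacobiSet_iff {x : EuclideanSpace ℝ (Fin 3)} (hx : x ∈ X) :
    x ∉ jacobiSet X f ↔ (fderivWithin ℝ f X x).range = ⊤ ∧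
      ∀ h : x ∈ domainBoundary X,
        IsLocalHomeomorphOn ((domainBoundary X).domRestrict f) {⟨x, h⟩} := by
  rw [← not_isSingularPoint_iff]
  by_cases hxi : x ∈ interior X
  · simp [jacobiSet, interiorJacobiSet, boundaryJacobiSet, domainBoundary, hxi]
  · simp [jacobiSet, interiorJacobiSet, boundaryJacobiSet, domainBoundary, hxi, hx]

theorem isOpen_compl_jacobiSet (hX : IsCornerDomain X) (hf : IsSmoothOn f X) :
    IsOpen {x : X | (x : EuclideanSpace ℝ (Fin 3)) ∉ jacobiSet X f} := by
  rw [isOpen_iff_mem_nhds]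
  rintro ⟨x, hx⟩ hxJ
  obtain ⟨hrk, hloc⟩ := (notMem_jacobiSet_iff hx).1 hxJ
  obtain ⟨U, g, hU, hxU, hg, hgf, hfd⟩ := exists_contDiffOn_extension hX hf hx
  rw [hfd x ⟨hx, hxU⟩] at hrk
  have hrank : ∀ᶠ z in 𝓝 x, z ∈ X → (fderivWithin ℝ f X z).range = ⊤ := by
    filter_upwards [eventually_range_fderiv_eq_top (hg x hxU) hrk, hU.mem_nhds hxU]
      with z hz hzU hzX
    rwa [hfd z ⟨hzX, hzU⟩]
  have hbdry : ∀ᶠ z in 𝓝 x, ∀ h : z ∈ domainBoundary X,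
      IsLocalHomeomorphOn ((domainBoundary X).domRestrict f) {⟨z, h⟩} := by
    by_cases hxi : x ∈ interior X
    · filter_upwards [isOpen_interior.mem_nhds hxi] with z hz h using absurd hz h.2
    · obtain ⟨e, hxe, he⟩ := hloc ⟨hx, hxi⟩ _ rfl
      obtain ⟨Q, hQ, hQe⟩ := isOpen_induced_iff.1 e.open_source
      have hxQ : x ∈ Q := by
        rw [← hQe] at hxe
        exact hxe
      filter_upwards [hQ.mem_nhds hxQ] with z hz h
      rintro _ rfl
      exact ⟨e, by rw [← hQe]; exact hz, he⟩
  have hboth := hrank.and hbdry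
  filter_upwards [(continuous_subtype_val.tendsto (⟨x, hx⟩ : X)).eventually hboth] with z hz
  exact (notMem_jacobiSet_iff z.2).2 ⟨hz.1 z.2, hz.2⟩

/-- Through each point `x ∈ X` off the Jacobi set there is a local section of `f` that is continuous
at `f x` and whose image contains all points of the boundary near `x`. At an interior point it
comes from the submersion `f`; at a boundary point it is the local inverse of `f|∂X`. -/
theorem exists_section_of_notMem_jacobiSet (hX : IsCornerDomain X) (hf : IsSmoothOn f X)
    {x : EuclideanSpace ℝ (Fin 3)} (hx : x ∈ X) (hxJ : x ∉ jacobiSet X f) :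
    ∃ (s : EuclideanSpace ℝ (Fin 2) → EuclideanSpace ℝ (Fin 3))
      (Q : Set (EuclideanSpace ℝ (Fin 3))), IsOpen Q ∧ x ∈ Q ∧ s (f x) = x ∧
      ContinuousAt s (f x) ∧ (∀ᶠ u in 𝓝 (f x), s u ∈ X ∧ f (s u) = u) ∧
      ∀ z ∈ X ∩ Q, z ∈ interior X ∨ s (f z) = z := by
  obtain ⟨hrk, hloc⟩ := (notMem_jacobiSet_iff hx).1 hxJ
  by_cases hxi : x ∈ interior X
  · obtain ⟨U, g, hU, hxU, hg, hgf, hfd⟩ := exists_contDiffOn_extension hX hf hx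
    rw [hfd x ⟨hx, hxU⟩] at hrk
    obtain ⟨s, hsx, hsc, hgs⟩ := exists_continuousAt_section (by simp) (hg x hxU) hrk
    rw [hgf ⟨hx, hxU⟩] at hsx hsc hgs
    refine ⟨s, interior X, isOpen_interior, hxi, hsx, hsc, ?_, fun z hz => Or.inl hz.2⟩
    filter_upwards [hgs, hsc (by
      rw [hsx]
      exact (isOpen_interior.inter hU).mem_nhds ⟨hxi, hxU⟩)] with u hu ⟨huX, huU⟩
    exact ⟨interior_subset huX, by rw [← hgf ⟨interior_subset huX, huU⟩, hu]⟩
  · obtain ⟨e, hxe, he⟩ := hloc ⟨hx, hxi⟩ _ rfl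
    have hef : ∀ z, e z = f z := fun z => (congrFun he z).symm
    obtain ⟨Q, hQ, hQe⟩ := isOpen_induced_iff.1 e.open_source
    have hfx : f x ∈ e.target := hef ⟨x, hx, hxi⟩ ▸ e.map_source hxe
    have hleft : ∀ z (h : z ∈ domainBoundary X), z ∈ Q →
        e.symm (f z) = (⟨z, h⟩ : domainBoundary X) := by
      intro z h hz
      rw [← hef ⟨z, h⟩]
      exact e.left_inv (by rw [← hQe]; exact hz)
    have hxQ : x ∈ Q := by
      rw [← hQe] at hxe
      exact hxe
    refine ⟨fun u => e.symm u, Q, hQ, hxQ, congrArg Subtype.val (hleft x ⟨hx, hxi⟩ hxQ),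
      continuous_subtype_val.continuousAt.comp (e.continuousAt_symm hfx), ?_, fun z hz => ?_⟩
    · filter_upwards [e.open_target.mem_nhds hfx] with u hu
      exact ⟨(e.symm u).2.1, by rw [← hef, e.right_inv hu]⟩
    · by_cases hzi : z ∈ interior X
      · exact Or.inl hzi
      · exact Or.inr (congrArg Subtype.val (hleft z ⟨hz.1, hzi⟩ hz.2))

theorem IsProperOn.isProperMap (hp : IsProperOn f X) (hf : ContinuousOn f X) :
    IsProperMap (X.domRestrict f) := by
  refine isProperMap_iff_isCompact_preimage.2 ⟨hf.domRestrict, fun K hK => ?_⟩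
  rw [Subtype.isCompact_iff]
  convert hp K hK using 1
  ext z
  simp [domRestrict, and_comm]

theorem nhds_le_map_of_notMem_jacobiSet (hX : IsCornerDomain X) (hf : IsSmoothOn f X) (x : X)
    (hxJ : (x : EuclideanSpace ℝ (Fin 3)) ∉ jacobiSet X f) :
    𝓝 (X.domRestrict f x) ≤ map (X.domRestrict f) (𝓝 x) := by
  obtain ⟨s, Q, -, -, hsx, hsc, hsX, -⟩ := exists_section_of_notMem_jacobiSet hX hf x.2 hxJ
  intro M hM
  rw [mem_map, nhds_subtype_eq_comap] at hM
  obtain ⟨N, hN, hNM⟩ := hM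
  filter_upwards [hsX, hsc (by rwa [hsx])] with u hu huN
  have h1 : (⟨s u, hu.1⟩ : X) ∈ X.domRestrict f ⁻¹' M := hNM huN
  rw [mem_preimage, domRestrict_apply] at h1
  rwa [hu.2] at h1

theorem exists_isOpen_isPreconnected_of_notMem_jacobiSet (hX : IsCornerDomain X)
    (hf : IsSmoothOn f X) (hp : IsProperOn f X) (x : X)
    (hxJ : (x : EuclideanSpace ℝ (Fin 3)) ∉ jacobiSet X f) :
    ∃ N : Set X, IsOpen N ∧ x ∈ N ∧
      ∀ᶠ u in 𝓝 (X.domRestrict f x), IsPreconnected (N ∩ X.domRestrict f ⁻¹' {u}) := by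
  obtain ⟨s, Q, hQ, hxQ, hsx, hsc, hsX, hint⟩ := exists_section_of_notMem_jacobiSet hX hf x.2 hxJ
  obtain ⟨U, g, hU, hxU, hg, hgf, hfd⟩ := exists_contDiffOn_extension hX hf x.2
  have hrk := ((notMem_jacobiSet_iff x.2).1 hxJ).1
  rw [hfd x ⟨x.2, hxU⟩] at hrk
  obtain ⟨N, hN, hxN, hNc⟩ := exists_isOpen_isPreconnected_fiber (by simp)
    (fun u => (hp {u} isCompact_singleton).isClosed) x.2 (hQ.inter hU) ⟨hxQ, hxU⟩ (hg x hxU) hrk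
    (fun z hz => hgf ⟨hz.1, hz.2.2⟩) hsx hsc hsX (fun z hz => hint z ⟨hz.1, hz.2.1⟩)
  refine ⟨Subtype.val ⁻¹' N, hN.preimage continuous_subtype_val, hxN, hNc.mono fun u hu => ?_⟩
  have himage : Subtype.val '' (Subtype.val ⁻¹' N ∩ X.domRestrict f ⁻¹' {u}) =
      X ∩ N ∩ f ⁻¹' {u} := by
    ext z
    simp [domRestrict]
    tauto
  rwa [← IsInducing.subtypeVal.isPreconnected_image, himage]

/-- The identifications of the Reeb space in terms of the subspace topology of `X`. -/
theorem reebMap_eq_iff (a b : X) :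
    reebMap X f a = reebMap X f b ↔
      b ∈ connectedComponentIn (X.domRestrict f ⁻¹' {X.domRestrict f a}) a := by
  have himage : Subtype.val '' (X.domRestrict f ⁻¹' {X.domRestrict f a}) = X ∩ f ⁻¹' {f a} := by
    ext z
    simp [domRestrict, and_comm]
  have hrel : reebMap X f a = reebMap X f b ↔ f a = f b ∧
      connectedComponentIn (X ∩ f ⁻¹' {f a}) (a : EuclideanSpace ℝ (Fin 3)) =
        connectedComponentIn (X ∩ f ⁻¹' {f b}) (b : EuclideanSpace ℝ (Fin 3)) :=
    Quotient.eq (r := reebSetoid X f)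
  rw [hrel]
  constructor
  · rintro ⟨hab, hc⟩
    have hb : (b : EuclideanSpace ℝ (Fin 3)) ∈ connectedComponentIn (X ∩ f ⁻¹' {f a}) a := by
      rw [hc]
      exact mem_connectedComponentIn ⟨b.2, rfl⟩
    have hsub := connectedComponentIn_subset (X ∩ f ⁻¹' {f a}) (a : EuclideanSpace ℝ (Fin 3))
    have hpre : IsPreconnected ((Subtype.val : X → _) ⁻¹'
        connectedComponentIn (X ∩ f ⁻¹' {f a}) (a : EuclideanSpace ℝ (Fin 3))) := by
      rw [← IsInducing.subtypeVal.isPreconnected_image, image_preimage_eq_of_subset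
        (by rw [Subtype.range_val]; exact hsub.trans inter_subset_left)]
      exact isPreconnected_connectedComponentIn
    exact hpre.subset_connectedComponentIn (mem_connectedComponentIn ⟨a.2, rfl⟩)
      (fun z hz => (hsub hz).2) hb
  · intro hb
    have hab : f b = f a := connectedComponentIn_subset (X.domRestrict f ⁻¹' {f a}) a hb
    refine ⟨hab.symm, ?_⟩
    rw [hab]
    refine connectedComponentIn_eq ?_
    rw [← himage]
    exact (continuous_subtype_val.continuousOn (s := X.domRestrict f ⁻¹'
      {X.domRestrict f a})).image_connectedComponentIn_subset rfl ⟨b, hb, rfl⟩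

end CornerDomain

/-! ### The Reeb space off the Jacobi structure -/

theorem lemma4p2 (X : Set (EuclideanSpace ℝ (Fin 3))) (hX : IsCornerDomain X)
    (f : EuclideanSpace ℝ (Fin 3) → EuclideanSpace ℝ (Fin 2))
    (hsmooth : IsSmoothOn f X) (hproper : IsProperOn f X) (hstable : IsStableOn f X) :
    ⋃₀ regularComponents X f = (jacobiStructure X f)ᶜ ∧
      (regularComponents X f).PairwiseDisjoint id ∧
      ∀ C ∈ regularComponents X f, IsOpen C ∧ IsTwoManifold C := by
  set R : Set X := {x : X | (x : EuclideanSpace ℝ (Fin 3)) ∉ jacobiSet X f} with hRdef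
  have hJ : jacobiStructure X f = reebMap X f '' Rᶜ := by
    rw [jacobiStructure, hRdef]
    congr 1
    ext x
    simp
  have hR : IsOpen R := isOpen_compl_jacobiSet hX hsmooth
  have hp : IsProperMap (X.domRestrict f) := hproper.isProperMap hsmooth.continuousOn
  have hopen := fun x (hx : x ∈ R) => nhds_le_map_of_notMem_jacobiSet hX hsmooth x hx
  have hconn := fun x (hx : x ∈ R) =>
    exists_isOpen_isPreconnected_of_notMem_jacobiSet hX hsmooth hproper x hx
  have hq : IsQuotientMap (reebMap X f) := isQuotientMap_quot_mk
  let fbar : ReebSpace X f → EuclideanSpace ℝ (Fin 2) :=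
    Quotient.lift (s := reebSetoid X f) (fun x : X => f x) fun _ _ h => h.1
  have hJo : IsOpen (jacobiStructure X f)ᶜ := by
    rw [hJ]
    exact isOpen_compl_image_compl hp hR hopen hconn hq reebMap_eq_iff
  have hloc : IsLocalHomeomorphOn fbar (jacobiStructure X f)ᶜ := by
    rw [hJ]
    exact isLocalHomeomorphOn_compl_image_compl hp hR hopen hconn hq reebMap_eq_iff fun _ => rfl
  refine ⟨Subset.antisymm ?_ fun s hs => ?_, ?_, ?_⟩
  · rintro t ⟨_, ⟨s, hs, rfl⟩, ht⟩
    exact ht.target_mem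
  · exact ⟨_, ⟨s, hs, rfl⟩, JoinedIn.refl hs⟩
  · rintro _ ⟨s, hs, rfl⟩ _ ⟨s', hs', rfl⟩ hne
    refine disjoint_left.2 fun t ht ht' => hne ?_
    ext v
    exact ⟨fun hv => (JoinedIn.trans ht' ht.symm).trans hv,
      fun hv => (JoinedIn.trans ht ht'.symm).trans hv⟩
  · rintro _ ⟨s, hs, rfl⟩
    set C := {t | JoinedIn (jacobiStructure X f)ᶜ s t}
    have hCJ : C ⊆ (jacobiStructure X f)ᶜ := fun t ht => ht.target_mem
    have hC : IsOpen C := isOpen_setOf_joinedIn hJo (hloc.nonempty_chartedSpace hJo) hs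
    have hchart : Nonempty (ChartedSpace (EuclideanSpace ℝ (Fin 2)) C) :=
      IsLocalHomeomorphOn.nonempty_chartedSpace (fun x hx => hloc x (hCJ hx)) hC
    refine ⟨hC, ⟨fun v w hvw => ?_⟩, ?_, hchart⟩
    · have hv := hCJ v.2
      have hw := hCJ w.2
      rw [hJ] at hv hw
      obtain ⟨V, V', hV, hV', hvV, hwV', hVV'⟩ := exists_disjoint_isOpen_of_compl_image_compl
        hp hR hopen hconn hq reebMap_eq_iff hv hw (fun h => hvw (Subtype.ext h))
      exact ⟨_, _, hV.preimage continuous_subtype_val, hV'.preimage continuous_subtype_val, hvV,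
        hwV', hVV'.preimage _⟩
    · refine secondCountableTopology_of_isLindelof ?_ hchart
      rw [← image_preimage_eq C hq.surjective]
      exact (HereditarilyLindelofSpace.isLindelof _).image hq.continuous
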